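/- **Real Low Basis Theorem.** For $p\in\mathbb N^{\mathbb N}$ let $p'\subseteq\mathbb N$ denote the Turing jump of $p$, that is, the halting problem relative to the oracle $p$, let $\emptyset'$ denote the jump of the empty set (the ordinary halting problem), and call $p$ *low* if $p'\leq_{\mathrm T}\emptyset'$. Fix the standard numbering $\nu_{\mathbb Q}\langle i,j,k\rangle=(i-j)/(k+1)$ of the rational numbers. A *Cauchy name* of a real number $x$ is a $p\in\mathbb N^{\mathbb N}$ such that the rational numbers $q_n:=\nu_{\mathbb Q}(p(n))$ satisfy $|q_i-q_k|\leq 2^{-i}$ for all $i<k$ and $\lim_{n\to\infty}q_n=x$. A set $A\subseteq\mathbb R$ is *co-c.e. closed* if there is a computable sequence of pairs of (codes of) rational numbers $(a_i,r_i)_{i\in\mathbb N}$ such that $\mathbb R\setminus A=\bigcup_{i\in\mathbb N}\{y\in\mathbb R:|y-a_i|<r_i\}$ (where $r_i\leq 0$, giving the empty ball, is allowed). Let $A\subseteq\mathbb R$ be a non-empty co-c.e. closed set. Then there is a point $x\in A$ that has a low Cauchy name, i.e. there is a $p\in\mathbb N^{\mathbb N}$ such that $p$ is a Cauchy name of $x$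 and $p'\leq_{\mathrm T}\emptyset'$. -/

import Mathlib

namespace LowBasis

/-- Programs for partial functions on `ℕ` with access to an oracle. Apart from being syntax, the
constructors are exactly those of Mathlib's `Nat.RecursiveIn`. -/
inductive OracleCode : Type
  | zero : OracleCode
  | succ : OracleCode
  | left : OracleCode
  | right : OracleCode
  | oracle : OracleCode
  | pair : OracleCode → OracleCode → OracleCode
  | comp : OracleCode → OracleCode → OracleCode
  | prec : OracleCode → OracleCode → OracleCode
  | rfind : OracleCode → OracleCode

namespace OracleCode

/-- The Gödel number of a program; this is a bijection between programs and natural numbers. -/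
def encode : OracleCode → ℕ
  | zero => 0
  | succ => 1
  | left => 2
  | right => 3
  | oracle => 4
  | pair c d => 4 * Nat.pair (encode c) (encode d) + 5
  | comp c d => 4 * Nat.pair (encode c) (encode d) + 6
  | prec c d => 4 * Nat.pair (encode c) (encode d) + 7
  | rfind c => 4 * encode c + 8

/-- The partial function computed by a program with oracle `g`. -/
def eval (g : ℕ →. ℕ) : OracleCode → ℕ →. ℕ
  | zero => fun _ => Part.some 0
  | succ => fun n => Part.some (n + 1)
  | left => fun n => Part.some (Nat.unpair n).1
  | right => fun n => Part.some (Nat.unpair n).2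
  | oracle => g
  | pair c d => fun n => Nat.pair <$> eval g c n <*> eval g d n
  | comp c d => fun n => eval g d n >>= eval g c
  | prec c d => fun p =>
      let (a, n) := Nat.unpair p
      n.rec (eval g c a) fun y IH => do
        let i ← IH
        eval g d (Nat.pair a (Nat.pair y i))
  | rfind c => fun a => Nat.rfind fun n => (fun m => decide (m = 0)) <$> eval g c (Nat.pair a n)

end OracleCode

/-- The Turing jump `p'` of a point `p` of Baire space: the set of all Gödel numbers of programs
that halt with oracle `p` on their own Gödel number. -/
def jump (p : ℕ → ℕ) : Set ℕ :=
  {e | ∃ c : OracleCode, c.encode = e ∧ (c.eval (p : ℕ →. ℕ) e).Dom}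

open Classical in
/-- The characteristic function of a set of natural numbers. -/
noncomputable def charFun (S : Set ℕ) : ℕ → ℕ := fun n => if n ∈ S then 1 else 0

/-- Turing reducibility `S ≤_T T` between sets of natural numbers. -/
def SetTuringReducible (S T : Set ℕ) : Prop :=
  TuringReducible (charFun S : ℕ →. ℕ) (charFun T : ℕ →. ℕ)

/-- The halting set `∅'`, i.e. the jump of the empty set. -/
noncomputable def emptyJump : Set ℕ := jump (charFun ∅)

/-- A point `p` of Baire space is low if `p' ≤_T ∅'`. -/
def IsLow (p : ℕ → ℕ) : Prop := SetTuringReducible (jump p) emptyJump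

/-- The standard numbering `⟨i, ⟨j, k⟩⟩ ↦ (i - j) / (k + 1)` of the rational numbers. -/
def ratOfNat (n : ℕ) : ℚ :=
  (((Nat.unpair n).1 : ℚ) - ((Nat.unpair (Nat.unpair n).2).1 : ℚ)) /
    (((Nat.unpair (Nat.unpair n).2).2 : ℚ) + 1)

/-- The Cauchy representation of the reals, as a relation: `p` is a name of `x` if it codes a
sequence of rationals that converges rapidly to `x`. -/
def IsCauchyName (p : ℕ → ℕ) (x : ℝ) : Prop :=
  (∀ i k : ℕ, i < k → |ratOfNat (p i) - ratOfNat (p k)| ≤ (1 / 2 : ℚ) ^ i) ∧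
    Filter.Tendsto (fun i => (ratOfNat (p i) : ℝ)) Filter.atTop (nhds x)

/-- The representation of closed sets by negative information, as a relation: `p` is a name of `A`
if it enumerates (pairs of codes of centre and radius of) rational open balls whose union is the
complement of `A`. Balls of radius `≤ 0` are empty, so that `A = ℝ` has names, too. -/
def IsNegativeName (p : ℕ → ℕ) (A : Set ℝ) : Prop :=
  Aᶜ = ⋃ i : ℕ, Metric.ball (ratOfNat (Nat.unpair (p i)).1 : ℝ)
    (ratOfNat (Nat.unpair (p i)).2 : ℝ)

/-- A set of reals is co-c.e. closed if it has a computable negative name. -/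
def IsCoCEClosed (A : Set ℝ) : Prop := ∃ p : ℕ → ℕ, Computable p ∧ IsNegativeName p A

end LowBasis

namespace LowBasis

open Nat.Partrec (Code)

/-! The proof transports the Jockusch–Soare low basis theorem along binary expansions. Fix a point
`z` of the set and work in the unit interval starting at `⌊z⌋`. A binary word is discarded once its
closed dyadic interval lies in a single ball of the enumerated complement; this is `Σ₁` and
inherited by extensions (`sigmaOne_isCovered`). The expansion of `z - ⌊z⌋` is never discarded.
Conversely, a sequence with no discarded prefix describes a point of the set, because the intervals
shrink to that point and the balls are open.

In Cantor space (`exists_isLow`), a decreasing sequence of nonempty closed sets is built. At stage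
`e`, program `e` is forced to diverge if this leaves the closed set nonempty; otherwise it halts on
every remaining point. Halting depends on a finite part of the oracle (`eval_eventually`), so by
compactness (`forall_exists_prefixNat_iff`) emptiness is a `Σ₁` question, which `∅'` answers. The
answers are exactly the jump of any point in the intersection. The oracle here is directly the
sequence of left endpoints, i.e. the Cauchy name, so lowness need not be transferred from the binary
digits. -/

/-- A predicate is `Σ₁` if it is the projection of a primitive recursive relation. -/
def SigmaOne {α : Type*} [Primcodable α] (p : α → Prop) : Prop :=
  ∃ R : α → ℕ → Prop, PrimrecRel R ∧ ∀ a, p a ↔ ∃ k, R a k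

/-! ### Closure properties of `Σ₁` predicates. -/

namespace SigmaOne

variable {α β : Type*} [Primcodable α] [Primcodable β]

theorem of_eq {p q : α → Prop} (hp : SigmaOne p) (h : ∀ a, p a ↔ q a) : SigmaOne q :=
  (funext fun a => propext (h a) : p = q) ▸ hp

theorem of_primrecPred {p : α → Prop} (hp : PrimrecPred p) : SigmaOne p :=
  ⟨fun a _ => p a, hp.comp Primrec.fst, fun a => by simp⟩

theorem comp {p : β → Prop} (hp : SigmaOne p) {f : α → β} (hf : Primrec f) :
    SigmaOne fun a => p (f a) := by
  obtain ⟨R, hR, h⟩ := hp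
  exact ⟨fun a k => R (f a) k, hR.comp (hf.comp Primrec.fst) Primrec.snd, fun a => h _⟩

theorem and {p q : α → Prop} (hp : SigmaOne p) (hq : SigmaOne q) :
    SigmaOne fun a => p a ∧ q a := by
  obtain ⟨R, hR, hp⟩ := hp
  obtain ⟨T, hT, hq⟩ := hq
  have hu : Primrec fun x : α × ℕ => x.2.unpair := Primrec.unpair.comp Primrec.snd
  refine ⟨fun a k => R a k.unpair.1 ∧ T a k.unpair.2,
    (hR.comp Primrec.fst (Primrec.fst.comp hu)).and
      (hT.comp Primrec.fst (Primrec.snd.comp hu)), fun a => ?_⟩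
  refine (and_congr (hp a) (hq a)).trans ?_
  constructor
  · rintro ⟨⟨k, hk⟩, ⟨l, hl⟩⟩
    exact ⟨Nat.pair k l, by simpa using ⟨hk, hl⟩⟩
  · rintro ⟨k, hk, hl⟩
    exact ⟨⟨_, hk⟩, ⟨_, hl⟩⟩

theorem or {p q : α → Prop} (hp : SigmaOne p) (hq : SigmaOne q) :
    SigmaOne fun a => p a ∨ q a := by
  obtain ⟨R, hR, hp⟩ := hp
  obtain ⟨T, hT, hq⟩ := hq
  refine ⟨fun a k => R a k ∨ T a k, hR.or hT, fun a => ?_⟩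
  exact (or_congr (hp a) (hq a)).trans exists_or.symm

theorem exists_nat {p : α × ℕ → Prop} (hp : SigmaOne p) : SigmaOne fun a => ∃ n, p (a, n) := by
  obtain ⟨R, hR, hp⟩ := hp
  have hu : Primrec fun x : α × ℕ => x.2.unpair := Primrec.unpair.comp Primrec.snd
  refine ⟨fun a k => R (a, k.unpair.1) k.unpair.2,
    hR.comp (Primrec.fst.pair (Primrec.fst.comp hu)) (Primrec.snd.comp hu), fun a => ?_⟩
  simp only [hp]
  constructor
  · rintro ⟨n, k, h⟩
    exact ⟨Nat.pair n k, by simpa using h⟩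
  · rintro ⟨k, h⟩
    exact ⟨_, _, h⟩

/-- Finitely many witnesses have a common bound, so the unbounded search can be moved in front of
the bounded quantifier. -/
theorem forall_lt {p : α × ℕ → Prop} (hp : SigmaOne p) {f : α → ℕ} (hf : Primrec f) :
    SigmaOne fun a => ∀ n < f a, p (a, n) := by
  obtain ⟨R, hR, hp⟩ := hp
  have h1 : PrimrecRel fun (k : ℕ) (x : α × ℕ) => ∃ i < k, R x i :=
    ((PrimrecRel.exists_mem_list (R := fun i (x : α × ℕ) => R x i) hR.swap).comp
      (Primrec.list_range.comp Primrec.fst) Primrec.snd).of_eq fun x => by simp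
  have h2 : PrimrecRel fun (m : ℕ) (y : α × ℕ) => ∀ n < m, ∃ i < y.2, R (y.1, n) i :=
    ((PrimrecRel.forall_mem_list (R := fun n (y : α × ℕ) => ∃ i < y.2, R (y.1, n) i)
      (h1.comp (Primrec.snd.comp Primrec.snd)
        ((Primrec.fst.comp Primrec.snd).pair Primrec.fst))).comp
      (Primrec.list_range.comp Primrec.fst) Primrec.snd).of_eq fun x => by simp
  refine ⟨fun a k => ∀ n < f a, ∃ i < k, R (a, n) i,
    h2.comp (hf.comp Primrec.fst) Primrec.id, fun a => ?_⟩
  simp only [hp]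
  constructor
  · intro h
    choose! g hg using h
    refine ⟨(Finset.range (f a)).sup g + 1, fun n hn => ⟨g n, ?_, hg n hn⟩⟩
    exact Nat.lt_succ_of_le (Finset.le_sup (Finset.mem_range.2 hn))
  · rintro ⟨k, h⟩ n hn
    obtain ⟨i, -, hi⟩ := h n hn
    exact ⟨i, hi⟩

/-- The step-bounded evaluation `Code.evaln` is primitive recursive, and a computation halts iff
some bound suffices. -/
theorem of_dom {f : α →. β} (hf : Partrec f) : SigmaOne fun a => (f a).Dom := by
  obtain ⟨c, hc⟩ := Code.exists_code.1 hf
  refine ⟨fun a k => (Code.evaln k c (Encodable.encode a)).isSome = true, ?_, fun a => ?_⟩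
  · exact Primrec.eq.comp (Primrec.option_isSome.comp (Code.primrec_evaln.comp
      ((Primrec.snd.pair (Primrec.const c)).pair (Primrec.encode.comp Primrec.fst))))
      (Primrec.const true)
  · have h1 : (c.eval (Encodable.encode a)).Dom ↔ (f a).Dom := by
      rw [hc]; simp
    refine h1.symm.trans ?_
    rw [Part.dom_iff_mem]
    simp only [Code.evaln_complete, Option.isSome_iff_exists]
    exact exists_comm

theorem of_computablePred {p : α → Prop} (hp : ComputablePred p) : SigmaOne p :=
  (of_dom hp.to_re).of_eq fun a => by simp [Part.assert]

/-- A `Σ₁` predicate on natural numbers is the domain of a partial recursive function. -/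
theorem exists_partrec {p : ℕ → Prop} (hp : SigmaOne p) :
    ∃ f : ℕ →. ℕ, Nat.Partrec f ∧ ∀ n, (f n).Dom ↔ p n := by
  classical
  obtain ⟨R, hR, hp⟩ := hp
  refine ⟨fun n => Nat.rfind fun k => Part.some (decide (R n k)), ?_, fun n => ?_⟩
  · exact Partrec.nat_iff.1 (Partrec.rfind (ComputablePred.decide
      (PrimrecPred.computablePred (p := fun x : ℕ × ℕ => R x.1 x.2) hR)).partrec)
  · refine Nat.rfind_dom.trans ?_
    rw [hp]
    simp

end SigmaOne

/-! ### Oracle programs: use principle and translation into ordinary programs. -/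

namespace OracleCode

theorem encode_surjective : Function.Surjective encode := by
  intro n
  induction n using Nat.strong_induction_on with
  | _ n ih =>
    match n, ih with
    | 0, _ => exact ⟨zero, rfl⟩
    | 1, _ => exact ⟨succ, rfl⟩
    | 2, _ => exact ⟨left, rfl⟩
    | 3, _ => exact ⟨right, rfl⟩
    | 4, _ => exact ⟨oracle, rfl⟩
    | n + 5, ih =>
      have hl := Nat.unpair_left_le (n / 4)
      have hr := Nat.unpair_right_le (n / 4)
      obtain ⟨c, hc⟩ := ih (n / 4).unpair.1 (by omega)
      obtain ⟨d, hd⟩ := ih (n / 4).unpair.2 (by omega)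
      obtain ⟨r, hr⟩ := ih (n / 4) (by omega)
      have h4 : n % 4 < 4 := Nat.mod_lt _ (by norm_num)
      have hn := Nat.div_add_mod n 4
      interval_cases h : n % 4
      · exact ⟨pair c d, by simp only [encode, hc, hd, Nat.pair_unpair]; omega⟩
      · exact ⟨comp c d, by simp only [encode, hc, hd, Nat.pair_unpair]; omega⟩
      · exact ⟨prec c d, by simp only [encode, hc, hd, Nat.pair_unpair]; omega⟩
      · exact ⟨rfind r, by simp only [encode, hr]; omega⟩

/-- The use principle: a halting computation keeps its value if the oracle changes only at
arguments that it does not ask for. -/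
theorem eval_eventually {ι : Type*} {l : Filter ι} {G : ι → ℕ →. ℕ} {g : ℕ →. ℕ}
    (h : ∀ x y, y ∈ g x → ∀ᶠ i in l, y ∈ G i x) (c : OracleCode) :
    ∀ x y, y ∈ c.eval g x → ∀ᶠ i in l, y ∈ c.eval (G i) x := by
  induction c with
  | zero | succ | left | right => exact fun x y hy => Filter.Eventually.of_forall fun _ => hy
  | oracle => exact h
  | pair c d ihc ihd =>
    intro x y hy
    simp only [eval, Seq.seq, Part.mem_bind_iff, Part.map_eq_map, Part.mem_map_iff] at hy ⊢
    obtain ⟨_, ⟨u, hu, rfl⟩, v, hv, rfl⟩ := hy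
    filter_upwards [ihc _ _ hu, ihd _ _ hv] with i h1 h2
    exact ⟨_, ⟨u, h1, rfl⟩, v, h2, rfl⟩
  | comp c d ihc ihd =>
    intro x y hy
    obtain ⟨u, hu, hv⟩ := Part.mem_bind_iff.1 hy
    filter_upwards [ihd _ _ hu, ihc _ _ hv] with i h1 h2
    exact Part.mem_bind_iff.2 ⟨u, h1, h2⟩
  | prec c d ihc ihd =>
    intro x y hy
    simp only [eval] at hy ⊢
    generalize x.unpair.1 = a at hy ⊢
    generalize x.unpair.2 = n at hy ⊢
    induction n generalizing y with
    | zero => exact ihc _ _ hy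
    | succ n ih =>
      simp only [Part.bind_eq_bind, Part.mem_bind_iff] at hy ⊢
      obtain ⟨u, hu, hv⟩ := hy
      filter_upwards [ih _ hu, ihd _ _ hv] with i h1 h2
      exact ⟨u, h1, h2⟩
  | rfind c ih =>
    intro x y hy
    obtain ⟨hz, hlt⟩ := Nat.mem_rfind.1 hy
    obtain ⟨u, hu, hu0⟩ := (Part.mem_map_iff _).1 hz
    -- A successful search up to `y` runs only finitely many computations, so their eventual
    -- validities can be intersected.
    have hall : ∀ᶠ i in l, ∀ m ∈ Set.Iio y,
        ∃ a ∈ c.eval (G i) (Nat.pair x m), decide (a = 0) = false := by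
      refine (Set.finite_Iio y).eventually_all.2 fun m hm => ?_
      obtain ⟨v, hv, hv0⟩ := (Part.mem_map_iff _).1 (hlt hm)
      filter_upwards [ih _ _ hv] with i h1
      exact ⟨v, h1, hv0⟩
    filter_upwards [ih _ _ hu, hall] with i h1 h2
    exact Nat.mem_rfind.2 ⟨(Part.mem_map_iff _).2 ⟨u, h1, hu0⟩,
      fun {m} hm => (Part.mem_map_iff _).2 (h2 m hm)⟩

/-- This is the use principle along the trivial filter on a one-point index type. -/
theorem eval_mono {g g' : ℕ →. ℕ} (h : ∀ x y, y ∈ g x → y ∈ g' x) (c : OracleCode) (x y : ℕ)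
    (hy : y ∈ c.eval g x) : y ∈ c.eval g' x :=
  Filter.eventually_pure.1 (eval_eventually (l := pure ()) (G := fun _ => g')
    (fun x y hy => Filter.eventually_pure.2 (h x y hy)) c x y hy)

/-- Every partial recursive function has a program that works with every oracle. -/
theorem exists_eval_eq {f : ℕ →. ℕ} (hf : Nat.Partrec f) :
    ∃ c : OracleCode, ∀ g, c.eval g = f := by
  induction hf with
  | zero => exact ⟨zero, fun g => rfl⟩
  | succ => exact ⟨succ, fun g => rfl⟩
  | left => exact ⟨left, fun g => rfl⟩
  | right => exact ⟨right, fun g => rfl⟩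
  | pair _ _ h1 h2 =>
    obtain ⟨c, hc⟩ := h1
    obtain ⟨d, hd⟩ := h2
    exact ⟨pair c d, fun g => by simp only [eval, hc, hd]; rfl⟩
  | comp _ _ h1 h2 =>
    obtain ⟨c, hc⟩ := h1
    obtain ⟨d, hd⟩ := h2
    exact ⟨comp c d, fun g => by simp only [eval, hc, hd]; rfl⟩
  | prec _ _ h1 h2 =>
    obtain ⟨c, hc⟩ := h1
    obtain ⟨d, hd⟩ := h2
    exact ⟨prec c d, fun g => by simp only [eval, hc, hd]; rfl⟩
  | rfind _ h1 =>
    obtain ⟨c, hc⟩ := h1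
    exact ⟨rfind c, fun g => by simp only [eval, hc]; rfl⟩

/-- The program, in Mathlib's sense, that results from the oracle program with a given Gödel
number when the oracle is computed by the program `o`. -/
def toCode (o : Code) : ℕ → Code
  | 0 => .zero
  | 1 => .succ
  | 2 => .left
  | 3 => .right
  | 4 => o
  | n + 5 =>
    have hm : n / 4 < n + 5 := by omega
    have _m1 : (n / 4).unpair.1 < n + 5 := lt_of_le_of_lt (n / 4).unpair_left_le hm
    have _m2 : (n / 4).unpair.2 < n + 5 := lt_of_le_of_lt (n / 4).unpair_right_le hm
    if n % 4 = 0 then .pair (toCode o (n / 4).unpair.1) (toCode o (n / 4).unpair.2)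
    else if n % 4 = 1 then .comp (toCode o (n / 4).unpair.1) (toCode o (n / 4).unpair.2)
    else if n % 4 = 2 then .prec (toCode o (n / 4).unpair.1) (toCode o (n / 4).unpair.2)
    -- `Code.rfind'` starts its search at the second component of its argument; pairing with `0`
    -- makes it start at `0`.
    else .comp (.rfind' (toCode o (n / 4))) (.pair Code.id .zero)

/-- Course-of-values recursion: the step function `G` receives the list of all earlier values, so
the length of the list is the current argument. All three possible subprograms are looked up
whatever the remainder mod 4; their indices are smaller than the argument, so no lookup fails. -/
theorem primrec_toCode : Primrec₂ toCode := by
  let B : ℕ → Code → Code → Code → Code := fun n s s₁ s₂ =>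
    if n % 4 = 0 then .pair s₁ s₂
    else if n % 4 = 1 then .comp s₁ s₂
    else if n % 4 = 2 then .prec s₁ s₂
    else .comp (.rfind' s) (.pair Code.id .zero)
  have hB : Primrec fun x : ℕ × Code × Code × Code => B x.1 x.2.1 x.2.2.1 x.2.2.2 := by
    have hn : Primrec fun x : ℕ × Code × Code × Code => x.1 % 4 :=
      Primrec.nat_mod.comp Primrec.fst (Primrec.const 4)
    have s := Primrec.fst.comp (Primrec.snd (α := ℕ) (β := Code × Code × Code))
    have s₁ := Primrec.fst.comp (Primrec.snd.comp (Primrec.snd (α := ℕ) (β := Code × Code × Code)))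
    have s₂ := Primrec.snd.comp (Primrec.snd.comp (Primrec.snd (α := ℕ) (β := Code × Code × Code)))
    exact Primrec.ite (Primrec.eq.comp hn (Primrec.const 0)) (Code.primrec₂_pair.comp s₁ s₂)
      (Primrec.ite (Primrec.eq.comp hn (Primrec.const 1)) (Code.primrec₂_comp.comp s₁ s₂)
        (Primrec.ite (Primrec.eq.comp hn (Primrec.const 2)) (Code.primrec₂_prec.comp s₁ s₂)
          (Code.primrec₂_comp.comp (Code.primrec_rfind'.comp s) (Primrec.const _))))
  let G₁ : List Code × ℕ → Option Code := fun p =>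
    p.1[p.2 / 4]?.bind fun s => p.1[(p.2 / 4).unpair.1]?.bind fun s₁ =>
      p.1[(p.2 / 4).unpair.2]?.map fun s₂ => B p.2 s s₁ s₂
  have hG₁ : Primrec G₁ := by
    have hm : Primrec fun p : List Code × ℕ => p.2 / 4 :=
      Primrec.nat_div.comp Primrec.snd (Primrec.const 4)
    have hu := Primrec.unpair.comp hm
    refine Primrec.option_bind (Primrec.list_getElem?.comp Primrec.fst hm) (.mk ?_)
    refine Primrec.option_bind ((Primrec.list_getElem?.comp Primrec.fst
      (Primrec.fst.comp hu)).comp Primrec.fst) (.mk ?_)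
    refine Primrec.option_map ((Primrec.list_getElem?.comp Primrec.fst
      (Primrec.snd.comp hu)).comp (Primrec.fst.comp Primrec.fst)) (.mk ?_)
    exact hB.comp ((Primrec.snd.comp (Primrec.fst.comp (Primrec.fst.comp Primrec.fst))).pair
      ((Primrec.snd.comp (Primrec.fst.comp Primrec.fst)).pair
        ((Primrec.snd.comp Primrec.fst).pair Primrec.snd)))
  let G : Code → List Code → Option Code := fun o L =>
    if L.length = 0 then some .zero
    else if L.length = 1 then some .succ
    else if L.length = 2 then some .left
    else if L.length = 3 then some .right
    else if L.length = 4 then some o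
    else G₁ (L, L.length - 5)
  have hG : Primrec₂ G := by
    have hL : Primrec fun x : Code × List Code => x.2.length :=
      Primrec.list_length.comp Primrec.snd
    have hc : ∀ n, PrimrecPred fun x : Code × List Code => x.2.length = n := fun n =>
      Primrec.eq.comp hL (Primrec.const n)
    exact .mk <| Primrec.ite (hc 0) (Primrec.const _) <| Primrec.ite (hc 1) (Primrec.const _) <|
      Primrec.ite (hc 2) (Primrec.const _) <| Primrec.ite (hc 3) (Primrec.const _) <|
      Primrec.ite (hc 4) (Primrec.option_some.comp Primrec.fst) <|
      hG₁.comp (Primrec.snd.pair (Primrec.nat_sub.comp hL (Primrec.const 5)))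
  refine Primrec.nat_strong_rec toCode hG fun o n => ?_
  match n with
  | 0 | 1 | 2 | 3 | 4 => simp [G, toCode]
  | n + 5 =>
    have hm : n / 4 < n + 5 := by omega
    have m1 : (n / 4).unpair.1 < n + 5 := lt_of_le_of_lt (n / 4).unpair_left_le hm
    have m2 : (n / 4).unpair.2 < n + 5 := lt_of_le_of_lt (n / 4).unpair_right_le hm
    simp [G, G₁, hm, m1, m2, B, toCode]

theorem eval_toCode (o : Code) (c : OracleCode) :
    (toCode o c.encode).eval = c.eval o.eval := by
  induction c with
  | zero | succ | left | right | oracle => simp [toCode, encode]; rfl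
  | pair c d ihc ihd =>
    rw [encode, toCode]
    simp [Code.eval, eval, ihc, ihd]
    rfl
  | comp c d ihc ihd =>
    have h1 : (4 * Nat.pair c.encode d.encode + 1) / 4 = Nat.pair c.encode d.encode := by omega
    have h2 : (4 * Nat.pair c.encode d.encode + 1) % 4 = 1 := by omega
    rw [encode, toCode]
    simp [h1, h2, Code.eval, eval, ihc, ihd]
    rfl
  | prec c d ihc ihd =>
    have h1 : (4 * Nat.pair c.encode d.encode + 2) / 4 = Nat.pair c.encode d.encode := by omega
    have h2 : (4 * Nat.pair c.encode d.encode + 2) % 4 = 2 := by omega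
    rw [encode, toCode]
    simp [h1, h2, Code.eval, eval, ihc, ihd]
    rfl
  | rfind c ih =>
    have h1 : (4 * c.encode + 3) / 4 = c.encode := by omega
    have h2 : (4 * c.encode + 3) % 4 = 3 := by omega
    rw [encode, toCode]
    funext x
    have h0 : (Code.pair Code.id Code.zero).eval x = Part.some (Nat.pair x 0) := by
      simp [Code.eval, Code.eval_id, Seq.seq, pure, PFun.pure]
    have h3 : ∀ d : Code, (Code.comp (.rfind' d) (.pair Code.id .zero)).eval x =
        Nat.rfind fun n => (fun m => decide (m = 0)) <$> d.eval (Nat.pair x n) := by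
      intro d
      change (Code.pair Code.id Code.zero).eval x >>= (Code.rfind' d).eval = _
      rw [h0]
      simp [Code.eval, Nat.unpaired, Part.map_id']
    simp only [h1, h2]
    exact (h3 _).trans (by rw [ih]; rfl)

end OracleCode

/-! ### Completeness of the halting problem, and recursion relative to an oracle. -/

/-- A `Σ₁` predicate is many-one reducible to the halting problem. -/
theorem SigmaOne.exists_primrec_emptyJump {Q : ℕ → Prop} (hQ : SigmaOne Q) :
    ∃ h : ℕ → ℕ, Primrec h ∧ ∀ n, h n ∈ emptyJump ↔ Q n := by
  obtain ⟨f, hf, hfQ⟩ := hQ.exists_partrec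
  obtain ⟨c, hc⟩ := OracleCode.exists_eval_eq hf
  -- `k n` is a program with constant value `n`. Thus `comp c (k n)` ignores its input and its
  -- oracle, and halts on its own Gödel number iff `f n` is defined.
  let k : ℕ → OracleCode := fun n => n.rec .zero fun _ d => .comp .succ d
  have hk : ∀ n g x, (k n).eval g x = Part.some n := by
    intro n g x
    induction n with
    | zero => rfl
    | succ n ih =>
      change (k n).eval g x >>= OracleCode.succ.eval g = _
      rw [ih]
      exact Part.bind_some _ _
  have hke : Primrec fun n => (k n).encode := by
    refine (Primrec.nat_rec₁ (f := fun _ i => 4 * Nat.pair 1 i + 6) 0 ?_).of_eq fun n => ?_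
    · exact Primrec.nat_add.comp (Primrec.nat_mul.comp (Primrec.const 4)
        (Primrec₂.natPair.comp (Primrec.const 1) Primrec.snd)) (Primrec.const 6)
    · induction n with
      | zero => rfl
      | succ n ih =>
        change 4 * Nat.pair 1 _ + 6 = 4 * Nat.pair 1 (k n).encode + 6
        rw [← ih]
  have hzero : ((charFun ∅ : ℕ → ℕ) : ℕ →. ℕ) = Code.zero.eval := by
    funext x
    simp [charFun, Code.eval]
    rfl
  refine ⟨fun n => (OracleCode.comp c (k n)).encode, ?_, fun n => ?_⟩
  · exact Primrec.nat_add.comp (Primrec.nat_mul.comp (Primrec.const 4)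
      (Primrec₂.natPair.comp (Primrec.const _) hke)) (Primrec.const 6)
  · have hev : ∀ g x, (OracleCode.comp c (k n)).eval g x = f n := by
      intro g x
      change (k n).eval g x >>= c.eval g = _
      rw [hk, hc]
      exact Part.bind_some _ _
    rw [← hfQ]
    constructor
    · rintro ⟨d, hd, hdom⟩
      -- Injectivity of `encode` is not needed: programs with equal numbers have the same
      -- translation, hence compute the same function with a computable oracle.
      rw [hzero, ← OracleCode.eval_toCode, hd, OracleCode.eval_toCode, hev] at hdom
      exact hdom
    · intro h
      exact ⟨_, rfl, by rw [hev]; exact h⟩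

theorem recursiveIn_comp_total {O : Set (ℕ →. ℕ)} {f g : ℕ → ℕ}
    (hf : Nat.RecursiveIn O (f : ℕ →. ℕ)) (hg : Nat.RecursiveIn O (g : ℕ →. ℕ)) :
    Nat.RecursiveIn O ((fun n => f (g n) : ℕ → ℕ) : ℕ →. ℕ) :=
  (hf.comp hg).of_eq fun n => Part.bind_some (g n) (f : ℕ →. ℕ)

theorem recursiveIn_pair_total {O : Set (ℕ →. ℕ)} {f g : ℕ → ℕ}
    (hf : Nat.RecursiveIn O (f : ℕ →. ℕ)) (hg : Nat.RecursiveIn O (g : ℕ →. ℕ)) :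
    Nat.RecursiveIn O ((fun n => Nat.pair (f n) (g n) : ℕ → ℕ) : ℕ →. ℕ) :=
  (hf.pair hg).of_eq fun n => by simp [Seq.seq]

theorem recursiveIn_of_primrec {O : Set (ℕ →. ℕ)} {f : ℕ → ℕ} (hf : Primrec f) :
    Nat.RecursiveIn O (f : ℕ →. ℕ) :=
  (Primrec.nat_iff.1 hf).recursiveIn

/-- Iterating a primitive recursive function that may put one question to an oracle at every
stage: the sequence of answers is recursive in the oracle. -/
theorem recursiveIn_answers {χ H T F : ℕ → ℕ} (hH : Primrec H) (hT : Primrec T)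
    (hF : ∀ e, F (e + 1) = T (Nat.pair (χ (H (Nat.pair e (F e)))) (Nat.pair e (F e)))) :
    Nat.RecursiveIn {(χ : ℕ →. ℕ)} ((fun e => χ (H (Nat.pair e (F e))) : ℕ → ℕ) : ℕ →. ℕ) := by
  have hχ : Nat.RecursiveIn {(χ : ℕ →. ℕ)} (χ : ℕ →. ℕ) := .oracle _ rfl
  have hr : Nat.RecursiveIn {(χ : ℕ →. ℕ)} ((fun w => w.unpair.2 : ℕ → ℕ) : ℕ →. ℕ) := .right
  have hid : Nat.RecursiveIn {(χ : ℕ →. ℕ)} ((fun w => w : ℕ → ℕ) : ℕ →. ℕ) :=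
    recursiveIn_of_primrec Primrec.id
  have hstep : Nat.RecursiveIn {(χ : ℕ →. ℕ)}
      ((fun w => T (Nat.pair (χ (H w.unpair.2)) w.unpair.2) : ℕ → ℕ) : ℕ →. ℕ) :=
    recursiveIn_comp_total (recursiveIn_of_primrec hT) (recursiveIn_pair_total
      (recursiveIn_comp_total hχ (recursiveIn_comp_total (recursiveIn_of_primrec hH) hr)) hr)
  -- The recursion carries a dummy parameter, set to `0` below; the step function therefore looks
  -- only at `w.unpair.2`, which codes the stage and the previous value.
  have hprec := Nat.RecursiveIn.prec
    (recursiveIn_of_primrec (O := {(χ : ℕ →. ℕ)}) (Primrec.const (F 0))) hstep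
  have hFrec : Nat.RecursiveIn {(χ : ℕ →. ℕ)} (F : ℕ →. ℕ) := by
    refine (hprec.comp (recursiveIn_pair_total
      (recursiveIn_of_primrec (Primrec.const 0)) hid)).of_eq fun e => ?_
    simp only [PFun.coe_val, Part.bind_eq_bind, Part.bind_some, Nat.unpair_pair]
    induction e with
    | zero => rfl
    | succ e ih =>
      simp only [ih, Part.bind_some, hF]
  exact recursiveIn_comp_total hχ (recursiveIn_comp_total (recursiveIn_of_primrec hH)
    (recursiveIn_pair_total hid hFrec))

/-! ### Binary words, Cantor space and finite oracles. -/

/-- The first `n` terms of a point of Cantor space, as the number with these binary digits. -/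
def prefixNat (b : ℕ → Bool) : ℕ → ℕ
  | 0 => 0
  | n + 1 => 2 * prefixNat b n + (b n).toNat

theorem prefixNat_lt (b : ℕ → Bool) (n : ℕ) : prefixNat b n < 2 ^ n := by
  induction n with
  | zero => simp [prefixNat]
  | succ n ih =>
    have := Bool.toNat_le (b n)
    rw [prefixNat, pow_succ]
    omega

theorem prefixNat_eq_div (b : ℕ → Bool) {j n : ℕ} (h : j ≤ n) :
    prefixNat b j = prefixNat b n / 2 ^ (n - j) := by
  induction n, h using Nat.le_induction with
  | base => simp
  | succ n hn ih =>
    have := Bool.toNat_le (b n)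
    rw [ih, Nat.succ_sub hn, pow_succ', ← Nat.div_div_eq_div_mul, prefixNat]
    congr 1
    omega

theorem continuous_prefixNat (n : ℕ) : Continuous fun b : ℕ → Bool => prefixNat b n := by
  induction n with
  | zero => exact continuous_const
  | succ n ih =>
    exact (continuous_const.mul ih).add ((continuous_of_discreteTopology (f := Bool.toNat)).comp
      (continuous_apply n))

theorem exists_prefixNat_eq {n k : ℕ} (hk : k < 2 ^ n) : ∃ b, prefixNat b n = k := by
  -- These are the `n` binary digits of `k`, most significant first; the prefix of length `j` is `k`
  -- without its last `n - j` digits.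
  refine ⟨fun i => decide (k / 2 ^ (n - i - 1) % 2 = 1), ?_⟩
  have h : ∀ j ≤ n, prefixNat (fun i => decide (k / 2 ^ (n - i - 1) % 2 = 1)) j =
      k / 2 ^ (n - j) := by
    intro j
    induction j with
    | zero => intro _; simp [prefixNat, Nat.div_eq_of_lt hk]
    | succ j ih =>
      intro hj
      have h1 : n - j = (n - (j + 1)) + 1 := by omega
      have h2 : k / 2 ^ (n - j) = k / 2 ^ (n - (j + 1)) / 2 := by
        rw [h1, pow_succ, Nat.div_div_eq_div_mul]
      rw [prefixNat, ih (by omega), h2, Nat.sub_sub]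
      rcases Nat.mod_two_eq_zero_or_one (k / 2 ^ (n - (j + 1))) with h | h <;>
        simp only [h] <;> simp <;> omega
  simpa using h n le_rfl

/-- The finite part of the oracle `j ↦ q j (prefixNat b j)` that is determined by
`k = prefixNat b n`. -/
def finiteOracle (q : ℕ → ℕ → ℕ) (n k : ℕ) : ℕ →. ℕ := fun j =>
  ((if j ≤ n then some (q j (k / 2 ^ (n - j))) else none : Option ℕ) : Part ℕ)

theorem mem_finiteOracle {q : ℕ → ℕ → ℕ} {n k j y : ℕ} :
    y ∈ finiteOracle q n k j ↔ j ≤ n ∧ q j (k / 2 ^ (n - j)) = y := by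
  unfold finiteOracle
  split_ifs with h <;> simp [h, eq_comm]

theorem mem_finiteOracle_prefixNat {q : ℕ → ℕ → ℕ} {b : ℕ → Bool} {n j y : ℕ} :
    y ∈ finiteOracle q n (prefixNat b n) j ↔ j ≤ n ∧ q j (prefixNat b j) = y := by
  rw [mem_finiteOracle]
  exact and_congr_right fun h => by rw [prefixNat_eq_div b h]

theorem primrec_two_pow : Primrec fun n : ℕ => 2 ^ n :=
  (Primrec.nat_rec₁ (f := fun _ i => 2 * i) 1
    (Primrec.nat_mul.comp (Primrec.const 2) Primrec.snd)).of_eq fun n => by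
      induction n with
      | zero => rfl
      | succ n ih => rw [pow_succ']; exact congrArg (2 * ·) ih

/-- Halting with a finite oracle, given by `(n, k)`, is a `Σ₁` property. -/
theorem sigmaOne_halts {q : ℕ → ℕ → ℕ} (hq : Primrec₂ q) :
    SigmaOne fun x : (ℕ × ℕ) × ℕ =>
      ∃ c : OracleCode, c.encode = x.2 ∧ (c.eval (finiteOracle q x.1.1 x.1.2) x.2).Dom := by
  let t : ℕ → ℕ → ℕ → Option ℕ := fun n k j =>
    if j ≤ n then some (q j (k / 2 ^ (n - j))) else none
  have hn := Primrec.fst.comp (Primrec.unpair.comp (Primrec.fst.comp Primrec.unpair))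
  have hk := Primrec.snd.comp (Primrec.unpair.comp (Primrec.fst.comp Primrec.unpair))
  have hj := Primrec.snd.comp Primrec.unpair
  have hp : Nat.Partrec fun w =>
      (t w.unpair.1.unpair.1 w.unpair.1.unpair.2 w.unpair.2 : Part ℕ) := by
    refine Partrec.nat_iff.1 (Computable.ofOption (Primrec.to_comp ?_))
    exact Primrec.ite (Primrec.nat_le.comp hj hn) (Primrec.option_some.comp (hq.comp hj
      (Primrec.nat_div.comp hk (primrec_two_pow.comp (Primrec.nat_sub.comp hn hj)))))
      (Primrec.const none)
  obtain ⟨o, ho⟩ := Code.exists_code.1 hp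
  -- Currying hard-wires the finite oracle into `o`, so a program for it depends primitive
  -- recursively on `(n, k)`; the universal function then runs the translated program.
  have hcur : ∀ n k, (o.curry (Nat.pair n k)).eval = finiteOracle q n k := by
    intro n k
    funext j
    rw [Code.eval_curry, ho]
    simp [finiteOracle, t]
  have hcode : Primrec fun x : (ℕ × ℕ) × ℕ =>
      OracleCode.toCode (o.curry (Nat.pair x.1.1 x.1.2)) x.2 :=
    OracleCode.primrec_toCode.comp (Code.primrec₂_curry.comp (Primrec.const o)
      (Primrec₂.natPair.comp (Primrec.fst.comp Primrec.fst) (Primrec.snd.comp Primrec.fst)))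
      Primrec.snd
  refine (SigmaOne.of_dom (Code.eval_part.comp hcode.to_comp Computable.snd)).of_eq fun x => ?_
  constructor
  · intro h
    obtain ⟨c, hc⟩ := OracleCode.encode_surjective x.2
    refine ⟨c, hc, ?_⟩
    rwa [← hc, OracleCode.eval_toCode, hcur, hc] at h
  · rintro ⟨c, hc, h⟩
    rwa [← hc, OracleCode.eval_toCode, hcur, hc]

/-- A uniformly `Σ₁` sequence of open subsets of Cantor space, given by monotone predicates on
finite prefixes: that the open set is the whole space is a `Σ₁` property. -/
theorem forall_exists_prefixNat_iff {K : ℕ → ℕ → Prop}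
    (hK : ∀ b n, K n (prefixNat b n) → K (n + 1) (prefixNat b (n + 1))) :
    (∀ b, ∃ n, K n (prefixNat b n)) ↔ ∃ n, ∀ k < 2 ^ n, K n k := by
  constructor
  · intro h
    let U : ℕ → Set (ℕ → Bool) := fun n => {b | K n (prefixNat b n)}
    have hU : Monotone U := monotone_nat_of_le_succ fun n b => hK b n
    -- Compactness: the open sets increase with `n`, so one of them is already the whole space.
    obtain ⟨n, hn⟩ := isCompact_univ.elim_directed_cover U
      (fun n => (isOpen_discrete {k | K n k}).preimage (continuous_prefixNat n))
      (fun b _ => Set.mem_iUnion.2 (h b)) hU.directed_le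
    refine ⟨n, fun k hk => ?_⟩
    obtain ⟨b, rfl⟩ := exists_prefixNat_eq hk
    exact hn (Set.mem_univ b)
  · rintro ⟨n, hn⟩ b
    exact ⟨n, hn _ (prefixNat_lt b n)⟩

/-! ### The low basis theorem in Cantor space. -/

/-- **Low Basis Theorem.** Let `W` be a `Σ₁` set of finite binary words. If some point of Cantor
space has no prefix in `W`, then there is such a point `b` for which the sequence
`j ↦ q j (prefixNat b j)` is low. -/
theorem exists_isLow {q : ℕ → ℕ → ℕ} (hq : Primrec₂ q) {W : ℕ → ℕ → Prop}
    (hW : SigmaOne fun x : ℕ × ℕ => W x.1 x.2)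
    (hmono : ∀ b n, W n (prefixNat b n) → W (n + 1) (prefixNat b (n + 1)))
    (hne : ∃ b, ∀ n, ¬ W n (prefixNat b n)) :
    ∃ b, (∀ n, ¬ W n (prefixNat b n)) ∧ IsLow fun j => q j (prefixNat b j) := by
  classical
  let V : ℕ → ℕ → ℕ → Prop := fun e n k =>
    ∃ c : OracleCode, c.encode = e ∧ (c.eval (finiteOracle q n k) e).Dom
  have hVmono : ∀ e b n, V e n (prefixNat b n) → V e (n + 1) (prefixNat b (n + 1)) := by
    rintro e b n ⟨c, hc, h⟩
    refine ⟨c, hc, Part.dom_iff_mem.2 ?_⟩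
    obtain ⟨y, hy⟩ := Part.dom_iff_mem.1 h
    refine ⟨y, OracleCode.eval_mono (fun x z hz => ?_) c e y hy⟩
    rw [mem_finiteOracle_prefixNat] at hz ⊢
    exact ⟨by omega, hz.2⟩
  have hVjump : ∀ e b, e ∈ jump (fun j => q j (prefixNat b j)) ↔ ∃ n, V e n (prefixNat b n) := by
    intro e b
    constructor
    · rintro ⟨c, hc, h⟩
      obtain ⟨y, hy⟩ := Part.dom_iff_mem.1 h
      have := OracleCode.eval_eventually (l := Filter.atTop)
        (G := fun n => finiteOracle q n (prefixNat b n)) (fun x z hz => by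
          filter_upwards [Filter.eventually_ge_atTop x] with n hn
          rw [mem_finiteOracle_prefixNat]
          exact ⟨hn, by simpa [eq_comm] using hz⟩) c e y hy
      obtain ⟨n, hn⟩ := this.exists
      exact ⟨n, c, hc, Part.dom_iff_mem.2 ⟨y, hn⟩⟩
    · rintro ⟨n, c, hc, h⟩
      obtain ⟨y, hy⟩ := Part.dom_iff_mem.1 h
      refine ⟨c, hc, Part.dom_iff_mem.2 ⟨y, OracleCode.eval_mono (fun x z hz => ?_) c e y hy⟩⟩
      rw [mem_finiteOracle_prefixNat] at hz
      simp [hz.2]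
  let K : List ℕ → ℕ → ℕ → Prop := fun l n k => W n k ∨ ∃ e, e ∈ l ∧ V e n k
  have hKmono : ∀ l b n, K l n (prefixNat b n) → K l (n + 1) (prefixNat b (n + 1)) := by
    rintro l b n (h | ⟨e, he, h⟩)
    · exact Or.inl (hmono b n h)
    · exact Or.inr ⟨e, he, hVmono e b n h⟩
  -- `Q l` says that no point avoids `W` while all programs in `l` diverge on their own numbers.
  -- Compactness will make this `Σ₁`.
  let Q : List ℕ → Prop := fun l => ∀ b, ∃ n, K l n (prefixNat b n)
  have hK : SigmaOne fun x : List ℕ × ℕ × ℕ => K x.1 x.2.1 x.2.2 := by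
    refine (hW.comp Primrec.snd).or (SigmaOne.exists_nat
      (p := fun y : (List ℕ × ℕ × ℕ) × ℕ => y.2 ∈ y.1.1 ∧ V y.2 y.1.2.1 y.1.2.2) ?_)
    refine SigmaOne.and (SigmaOne.of_primrecPred ?_) ?_
    · exact ((PrimrecRel.exists_mem_list (R := fun a b : ℕ => a = b) Primrec.eq).comp
        (Primrec.fst.comp Primrec.fst) Primrec.snd).of_eq fun x => by simp
    · exact (sigmaOne_halts hq).comp
        (((Primrec.fst.comp (Primrec.snd.comp Primrec.fst)).pair
          (Primrec.snd.comp (Primrec.snd.comp Primrec.fst))).pair Primrec.snd)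
  have hQ : SigmaOne Q := by
    refine (SigmaOne.exists_nat (p := fun x : List ℕ × ℕ => ∀ k < 2 ^ x.2, K x.1 x.2 k)
      (SigmaOne.forall_lt (p := fun y : (List ℕ × ℕ) × ℕ => K y.1.1 y.1.2 y.2) ?_
        (primrec_two_pow.comp Primrec.snd))).of_eq fun l =>
          (forall_exists_prefixNat_iff (hKmono l)).symm
    exact hK.comp ((Primrec.fst.comp Primrec.fst).pair
      ((Primrec.snd.comp Primrec.fst).pair Primrec.snd))
  let dec : ℕ → List ℕ := Denumerable.ofNat (List ℕ)
  have hdec : Primrec dec := Primrec.ofNat _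
  obtain ⟨h, hh, hhQ⟩ := (hQ.comp hdec).exists_primrec_emptyJump
  let cons : ℕ → ℕ := fun w => Encodable.encode (w.unpair.1 :: dec w.unpair.2)
  have hcons : Primrec cons := Primrec.encode.comp (Primrec.list_cons.comp
    (Primrec.fst.comp Primrec.unpair) (hdec.comp (Primrec.snd.comp Primrec.unpair)))
  -- The argument is `⟨answer, ⟨e, code of the list⟩⟩`; answer `1` means that divergence of `e`
  -- cannot be forced, and the list stays unchanged.
  let T : ℕ → ℕ := fun w => if w.unpair.1 = 1 then w.unpair.2.unpair.2 else cons w.unpair.2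
  have hT : Primrec T := Primrec.ite
    (Primrec.eq.comp (Primrec.fst.comp Primrec.unpair) (Primrec.const 1))
    (Primrec.snd.comp (Primrec.unpair.comp (Primrec.snd.comp Primrec.unpair)))
    (hcons.comp (Primrec.snd.comp Primrec.unpair))
  -- `S e` lists the programs below `e` that have been forced to diverge.
  let S : ℕ → List ℕ := fun e => e.rec [] fun e l => if Q (e :: l) then l else e :: l
  have hS : ∀ e, S (e + 1) = if Q (e :: S e) then S e else e :: S e := fun _ => rfl
  have hans : ∀ e, charFun emptyJump (h (cons (Nat.pair e (Encodable.encode (S e))))) =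
      if Q (e :: S e) then 1 else 0 := by
    intro e
    simp only [charFun, hhQ]
    simp [cons, dec]
  have hrec := recursiveIn_answers (χ := charFun emptyJump) (H := fun w => h (cons w)) (T := T)
    (F := fun e => Encodable.encode (S e)) (hh.comp hcons) hT fun e => by
      rw [hans, hS]
      by_cases hq : Q (e :: S e) <;> simp [hq, T, cons, dec]
  let P : ℕ → Set (ℕ → Bool) := fun e => {b | ∀ n, ¬ K (S e) n (prefixNat b n)}
  have hPanti : ∀ e, P (e + 1) ⊆ P e := by
    intro e b hb n hn
    refine hb n ?_
    rw [hS]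
    split_ifs
    · exact hn
    · exact hn.imp id fun ⟨i, hi, hV⟩ => ⟨i, List.mem_cons_of_mem _ hi, hV⟩
  have hPne : ∀ e, (P e).Nonempty := by
    intro e
    induction e with
    | zero =>
      obtain ⟨b, hb⟩ := hne
      exact ⟨b, fun n hn => hn.elim (hb n) (by simp [S])⟩
    | succ e ih =>
      by_cases hq : Q (e :: S e)
      · have : P (e + 1) = P e := by simp only [P, hS, if_pos hq]
        rwa [this]
      · obtain ⟨b, hb⟩ := not_forall.1 hq
        refine ⟨b, fun n hn => hb ⟨n, ?_⟩⟩
        rwa [hS, if_neg hq] at hn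
  have hPclosed : ∀ e, IsClosed (P e) := by
    intro e
    simp only [P, Set.ofPred_forall]
    exact isClosed_iInter fun n =>
      (isClosed_discrete {k | ¬ K (S e) n k}).preimage (continuous_prefixNat n)
  obtain ⟨b, hb⟩ := IsCompact.nonempty_iInter_of_sequence_nonempty_isCompact_isClosed P hPanti
    hPne (hPclosed 0).isCompact hPclosed
  have hbP : ∀ e, b ∈ P e := Set.mem_iInter.1 hb
  refine ⟨b, fun n hn => hbP 0 n (Or.inl hn), ?_⟩
  -- The stage-`e` answer decides the jump: if `Q` fails, `e` enters the list and diverges at `b`.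
  -- If `Q` holds, some prefix of `b` is excluded, and since `b ∈ P e` only the halting of `e` can
  -- be the cause.
  have hjump : ∀ e, e ∈ jump (fun j => q j (prefixNat b j)) ↔ Q (e :: S e) := by
    intro e
    rw [hVjump]
    constructor
    · rintro ⟨n, hn⟩
      by_contra hq
      refine hbP (e + 1) n ?_
      rw [hS, if_neg hq]
      exact Or.inr ⟨e, List.mem_cons_self, hn⟩
    · intro hq
      obtain ⟨n, hn | ⟨i, hi, hV⟩⟩ := hq b
      · exact absurd (Or.inl hn) (hbP e n)
      · rcases List.mem_cons.1 hi with rfl | hi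
        · exact ⟨n, hV⟩
        · exact absurd (Or.inr ⟨i, hi, hV⟩) (hbP e n)
  refine RecursiveIn.iff_nat.2 (hrec.of_eq fun e => ?_)
  rw [PFun.coe_val, hans, PFun.coe_val]
  simp only [charFun, hjump]

/-! ### Dyadic intervals and their coding. -/

/-- A code of the rational number `a - c + k / 2 ^ j`. -/
def dyadicCode (a c j k : ℕ) : ℕ :=
  -- `ratOfNat` adds `1` to the coded denominator, hence `2 ^ j - 1`.
  Nat.pair (a * 2 ^ j + k) (Nat.pair (c * 2 ^ j) (2 ^ j - 1))

theorem ratOfNat_dyadicCode (a c j k : ℕ) :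
    ratOfNat (dyadicCode a c j k) = a - c + k / 2 ^ j := by
  have h : ((2 ^ j - 1 : ℕ) : ℚ) + 1 = 2 ^ j := by
    rw [Nat.cast_sub Nat.one_le_two_pow]
    push_cast
    ring
  simp only [ratOfNat, dyadicCode, Nat.unpair_pair, h]
  push_cast
  field_simp
  ring

theorem primrec_dyadicCode (a c : ℕ) : Primrec₂ (dyadicCode a c) := by
  have hp : Primrec fun x : ℕ × ℕ => 2 ^ x.1 := primrec_two_pow.comp Primrec.fst
  exact Primrec₂.natPair.comp
    (Primrec.nat_add.comp (Primrec.nat_mul.comp (Primrec.const a) hp) Primrec.snd)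
    (Primrec₂.natPair.comp (Primrec.nat_mul.comp (Primrec.const c) hp)
      (Primrec.nat_sub.comp hp (Primrec.const 1)))

/-- Comparison of one coded rational number with the sum of two others is decidable. -/
theorem primrecPred_lt_add : PrimrecPred fun x : ℕ × ℕ × ℕ =>
    ratOfNat x.1 < ratOfNat x.2.1 + ratOfNat x.2.2 := by
  let p : ℕ → ℕ := fun n => n.unpair.1
  let m : ℕ → ℕ := fun n => n.unpair.2.unpair.1
  let d : ℕ → ℕ := fun n => n.unpair.2.unpair.2 + 1
  have hp : Primrec p := Primrec.fst.comp Primrec.unpair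
  have hu : Primrec fun n : ℕ => n.unpair.2.unpair :=
    Primrec.unpair.comp (Primrec.snd.comp Primrec.unpair)
  have hm : Primrec m := Primrec.fst.comp hu
  have hd : Primrec d := Primrec.succ.comp (Primrec.snd.comp hu)
  have hr : ∀ n, ratOfNat n = ((p n : ℚ) - m n) / d n := fun n => by
    simp [ratOfNat, p, m, d]
  have h1 := Primrec.fst (α := ℕ) (β := ℕ × ℕ)
  have h2 := Primrec.fst.comp (Primrec.snd (α := ℕ) (β := ℕ × ℕ))
  have h3 := Primrec.snd.comp (Primrec.snd (α := ℕ) (β := ℕ × ℕ))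
  have mul3 : ∀ {f g h : ℕ × ℕ × ℕ → ℕ}, Primrec f → Primrec g → Primrec h →
      Primrec fun x => f x * g x * h x := fun hf hg hh =>
    Primrec.nat_mul.comp (Primrec.nat_mul.comp hf hg) hh
  have add3 : ∀ {f g h : ℕ × ℕ × ℕ → ℕ}, Primrec f → Primrec g → Primrec h →
      Primrec fun x => f x + g x + h x := fun hf hg hh =>
    Primrec.nat_add.comp (Primrec.nat_add.comp hf hg) hh
  have hlt := Primrec.nat_lt.comp
    -- Denominators are cleared and negative parts moved across, so that the comparison stays in
    -- `ℕ`.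
    (add3 (mul3 (hp.comp h1) (hd.comp h2) (hd.comp h3))
      (mul3 (hm.comp h2) (hd.comp h1) (hd.comp h3)) (mul3 (hm.comp h3) (hd.comp h1) (hd.comp h2)))
    (add3 (mul3 (hm.comp h1) (hd.comp h2) (hd.comp h3))
      (mul3 (hp.comp h2) (hd.comp h1) (hd.comp h3)) (mul3 (hp.comp h3) (hd.comp h1) (hd.comp h2)))
  refine hlt.of_eq fun ⟨u, v, w⟩ => ?_
  have hpos : ∀ n, (0 : ℚ) < d n := fun n => Nat.cast_pos.2 (Nat.succ_pos _)
  have hu := hpos u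
  have hv := hpos v
  have hw := hpos w
  simp only [hr]
  rw [div_add_div _ _ hv.ne' hw.ne', div_lt_div_iff₀ hu (mul_pos hv hw), ← Nat.cast_lt (α := ℚ)]
  push_cast
  constructor <;> intro h <;> linarith

/-- The dyadic interval `[a - c + k / 2 ^ n, a - c + (k + 1) / 2 ^ n]` is covered by one of the
balls in the sequence `p`. -/
def IsCovered (p : ℕ → ℕ) (a c n k : ℕ) : Prop :=
  ∃ i, ratOfNat (dyadicCode a c n (k + 1)) <
      ratOfNat (p i).unpair.1 + ratOfNat (p i).unpair.2 ∧
    ratOfNat (p i).unpair.1 < ratOfNat (dyadicCode a c n k) + ratOfNat (p i).unpair.2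

/-- Since `p` is merely computable, the comparisons are decidable but perhaps not primitive
recursive; they enter through `of_computablePred`. -/
theorem sigmaOne_isCovered {p : ℕ → ℕ} (hp : Computable p) (a c : ℕ) :
    SigmaOne fun x : ℕ × ℕ => IsCovered p a c x.1 x.2 := by
  obtain ⟨_, hlt⟩ := primrecPred_lt_add.computablePred
  have hpi : Computable fun y : (ℕ × ℕ) × ℕ => (p y.2).unpair :=
    Computable.unpair.comp (hp.comp Computable.snd)
  have h1 := Computable.fst.comp hpi
  have h2 := Computable.snd.comp hpi
  have hk : Computable fun y : (ℕ × ℕ) × ℕ => dyadicCode a c y.1.1 y.1.2 :=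
    ((primrec_dyadicCode a c).comp (Primrec.fst.comp Primrec.fst)
      (Primrec.snd.comp Primrec.fst)).to_comp
  have hk' : Computable fun y : (ℕ × ℕ) × ℕ => dyadicCode a c y.1.1 (y.1.2 + 1) :=
    ((primrec_dyadicCode a c).comp (Primrec.fst.comp Primrec.fst)
      (Primrec.succ.comp (Primrec.snd.comp Primrec.fst))).to_comp
  exact SigmaOne.exists_nat (SigmaOne.and
    (SigmaOne.of_computablePred ⟨_, hlt.comp (hk'.pair (h1.pair h2))⟩)
    (SigmaOne.of_computablePred ⟨_, hlt.comp (h1.pair (hk.pair h2))⟩))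

theorem isCovered_iff {p : ℕ → ℕ} {a c n k : ℕ} : IsCovered p a c n k ↔
    ∃ i, ((a - c + (k + 1) / 2 ^ n : ℝ) <
        ratOfNat (p i).unpair.1 + ratOfNat (p i).unpair.2) ∧
      (ratOfNat (p i).unpair.1 : ℝ) < a - c + k / 2 ^ n + ratOfNat (p i).unpair.2 := by
  unfold IsCovered
  simp only [ratOfNat_dyadicCode, ← Rat.cast_lt (K := ℝ)]
  push_cast
  rfl

/-- Together with `succ_prefixNat_div_le` this says that the dyadic intervals are nested, which
gives both the persistence of covering and the Cauchy estimate. -/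
theorem prefixNat_div_le_succ (b : ℕ → Bool) (n : ℕ) :
    (prefixNat b n / 2 ^ n : ℝ) ≤ prefixNat b (n + 1) / 2 ^ (n + 1) := by
  rw [div_le_div_iff₀ (by positivity) (by positivity), prefixNat, pow_succ]
  push_cast
  have : (0 : ℝ) ≤ ((b n).toNat : ℝ) * 2 ^ n := by positivity
  nlinarith

theorem succ_prefixNat_div_le (b : ℕ → Bool) (n : ℕ) :
    ((prefixNat b (n + 1) + 1) / 2 ^ (n + 1) : ℝ) ≤ (prefixNat b n + 1) / 2 ^ n := by
  have h : ((b n).toNat : ℝ) ≤ 1 := by exact_mod_cast Bool.toNat_le (b n)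
  have h' := mul_le_mul_of_nonneg_right h (by positivity : (0 : ℝ) ≤ 2 ^ n)
  rw [div_le_div_iff₀ (by positivity) (by positivity), prefixNat, pow_succ]
  push_cast
  nlinarith

/-- Every point of Cantor space is the binary expansion of a real number in `[0, 1]`. -/
theorem exists_real_of_digits (b : ℕ → Bool) :
    ∃ y : ℝ, ∀ n, (prefixNat b n / 2 ^ n : ℝ) ≤ y ∧ y ≤ (prefixNat b n + 1) / 2 ^ n := by
  have hmono : Monotone fun n => (prefixNat b n / 2 ^ n : ℝ) :=
    monotone_nat_of_le_succ (prefixNat_div_le_succ b)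
  have hanti : Antitone fun n => ((prefixNat b n + 1) / 2 ^ n : ℝ) :=
    antitone_nat_of_succ_le (succ_prefixNat_div_le b)
  have hle : ∀ m n, (prefixNat b m / 2 ^ m : ℝ) ≤ (prefixNat b n + 1) / 2 ^ n := fun m n =>
    calc (prefixNat b m / 2 ^ m : ℝ) ≤ prefixNat b (max m n) / 2 ^ max m n :=
          hmono (le_max_left m n)
      _ ≤ (prefixNat b (max m n) + 1) / 2 ^ max m n := by gcongr; simp
      _ ≤ _ := hanti (le_max_right m n)
  have hbdd : BddAbove (Set.range fun m => (prefixNat b m / 2 ^ m : ℝ)) :=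
    ⟨_, Set.forall_mem_range.2 fun m => hle m 0⟩
  exact ⟨⨆ m, (prefixNat b m / 2 ^ m : ℝ), fun n =>
    ⟨le_ciSup hbdd n, ciSup_le fun m => hle m n⟩⟩

/-- Every real number in `[0, 1)` has a binary expansion. -/
theorem exists_digits_of_real {y : ℝ} (h0 : 0 ≤ y) (h1 : y < 1) :
    ∃ b : ℕ → Bool, ∀ n, (prefixNat b n / 2 ^ n : ℝ) ≤ y ∧ y < (prefixNat b n + 1) / 2 ^ n := by
  -- The digit is the parity of `⌊y * 2 ^ (n + 1)⌋₊`, so the prefix of length `n` is `⌊y * 2 ^ n⌋₊`;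
  -- at `n = 0` this needs `y < 1`.
  let b : ℕ → Bool := fun n => decide (⌊y * 2 ^ (n + 1)⌋₊ % 2 = 1)
  have hb : ∀ n, prefixNat b n = ⌊y * 2 ^ n⌋₊ := by
    intro n
    induction n with
    | zero => simp [prefixNat, Nat.floor_eq_zero.2 h1]
    | succ n ih =>
      have hhalf : ⌊y * 2 ^ n⌋₊ = ⌊y * 2 ^ (n + 1)⌋₊ / 2 := by
        rw [← Nat.floor_div_natCast]
        congr 1
        push_cast
        ring
      rw [prefixNat, ih, hhalf]
      rcases Nat.mod_two_eq_zero_or_one ⌊y * 2 ^ (n + 1)⌋₊ with h | h <;>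
        simp only [b, h] <;> simp <;> omega
  refine ⟨b, fun n => ?_⟩
  rw [hb, div_le_iff₀ (by positivity), lt_div_iff₀ (by positivity)]
  exact ⟨Nat.floor_le (by positivity), Nat.lt_floor_add_one _⟩

end LowBasis

/-! ### Transfer to the real line. -/

theorem mainTheorem10 (A : Set ℝ) (hA : LowBasis.IsCoCEClosed A) (hne : A.Nonempty) :
    ∃ x ∈ A, ∃ p : ℕ → ℕ, LowBasis.IsCauchyName p x ∧ LowBasis.IsLow p := by
  open LowBasis in
  obtain ⟨p, hp, hpA⟩ := hA
  obtain ⟨z, hz⟩ := hne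
  -- The numbering of rationals uses natural numbers only, so `⌊z⌋` is written as a difference.
  obtain ⟨a, c, hac⟩ : ∃ a c : ℕ, (⌊z⌋ : ℝ) = a - c := by
    refine ⟨⌊z⌋.toNat, (-⌊z⌋).toNat, ?_⟩
    exact_mod_cast (Int.toNat_sub_toNat_neg ⌊z⌋).symm
  have hcompl : ∀ x, x ∉ A ↔ ∃ i, x < ratOfNat (p i).unpair.1 + ratOfNat (p i).unpair.2 ∧
      (ratOfNat (p i).unpair.1 : ℝ) < x + ratOfNat (p i).unpair.2 := by
    intro x
    rw [← Set.mem_compl_iff, hpA]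
    simp only [Set.mem_iUnion, Metric.mem_ball, Real.dist_eq, abs_lt]
    refine exists_congr fun i => ?_
    constructor <;> rintro ⟨h1, h2⟩ <;> constructor <;> linarith
  have hmono : ∀ b n, IsCovered p a c n (prefixNat b n) →
      IsCovered p a c (n + 1) (prefixNat b (n + 1)) := by
    intro b n h
    rw [isCovered_iff] at h ⊢
    obtain ⟨i, h1, h2⟩ := h
    have h3 := prefixNat_div_le_succ b n
    have h4 := succ_prefixNat_div_le b n
    exact ⟨i, by linarith, by linarith⟩
  have hstart : ∃ b, ∀ n, ¬ IsCovered p a c n (prefixNat b n) := by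
    obtain ⟨b, hb⟩ := exists_digits_of_real (y := z - ⌊z⌋)
      (sub_nonneg.2 (Int.floor_le z)) (by linarith [Int.lt_floor_add_one z])
    refine ⟨b, fun n hn => ?_⟩
    obtain ⟨i, h1, h2⟩ := isCovered_iff.1 hn
    obtain ⟨h3, h4⟩ := hb n
    exact (hcompl z).2 ⟨i, by linarith, by linarith⟩ hz
  obtain ⟨b, hb, hlow⟩ :=
    exists_isLow (primrec_dyadicCode a c) (sigmaOne_isCovered hp a c) hmono hstart
  obtain ⟨y, hy⟩ := exists_real_of_digits b
  have hpow : Filter.Tendsto (fun n : ℕ => ((1 / 2 : ℝ)) ^ n) Filter.atTop (nhds 0) :=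
    tendsto_pow_atTop_nhds_zero_of_lt_one (by norm_num) (by norm_num)
  have hsplit : ∀ n, ((prefixNat b n + 1) / 2 ^ n : ℝ) = prefixNat b n / 2 ^ n + (1 / 2) ^ n := by
    intro n
    rw [add_div, one_div_pow]
  have hlim : Filter.Tendsto (fun n => (prefixNat b n / 2 ^ n : ℝ)) Filter.atTop (nhds y) := by
    refine tendsto_of_tendsto_of_tendsto_of_le_of_le (g := fun n => y - (1 / 2) ^ n)
      (h := fun _ => y) (by simpa using hpow.const_sub y) tendsto_const_nhds
      (fun n => ?_) fun n => (hy n).1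
    have := (hy n).2
    rw [hsplit] at this
    simpa using this
  refine ⟨a - c + y, ?_, _, ⟨fun i k hik => ?_, ?_⟩, hlow⟩
  -- Otherwise the point lies in one of the open balls. Both endpoints of its dyadic intervals
  -- converge to it, so some interval lies in that ball and a prefix of `b` is covered.
  · by_contra hx
    obtain ⟨i, h1, h2⟩ := (hcompl _).1 hx
    have e1 : ∀ᶠ n in Filter.atTop, (a - c + (prefixNat b n / 2 ^ n + (1 / 2) ^ n) : ℝ) <
        ratOfNat (p i).unpair.1 + ratOfNat (p i).unpair.2 :=
      ((hlim.add hpow).const_add _).eventually_lt_const (by simpa using h1)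
    have e2 : ∀ᶠ n in Filter.atTop, (ratOfNat (p i).unpair.1 : ℝ) <
        a - c + prefixNat b n / 2 ^ n + ratOfNat (p i).unpair.2 :=
      ((hlim.const_add _).add_const _).eventually_const_lt h2
    obtain ⟨n, h3, h4⟩ := (e1.and e2).exists
    exact hb n (isCovered_iff.2 ⟨i, by rwa [hsplit], h4⟩)
  · simp only [ratOfNat_dyadicCode]
    rw [← Rat.cast_le (K := ℝ)]
    push_cast
    -- Both left endpoints lie in the level-`i` interval, which has length `2 ^ (-i)`.
    have hm : (prefixNat b i / 2 ^ i : ℝ) ≤ prefixNat b k / 2 ^ k :=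
      monotone_nat_of_le_succ (f := fun n => (prefixNat b n / 2 ^ n : ℝ))
        (prefixNat_div_le_succ b) hik.le
    have hM : ((prefixNat b k + 1) / 2 ^ k : ℝ) ≤ (prefixNat b i + 1) / 2 ^ i :=
      antitone_nat_of_succ_le (f := fun n => ((prefixNat b n + 1) / 2 ^ n : ℝ))
        (succ_prefixNat_div_le b) hik.le
    rw [hsplit, hsplit] at hM
    have hk : (0 : ℝ) < (1 / 2) ^ k := by positivity
    rw [abs_le]
    constructor <;> linarith
  · simp only [ratOfNat_dyadicCode]
    push_cast
    exact hlim.const_add _
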